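/- Let $H_1, H_2$ be infinite-dimensional separable complex Hilbert spaces. A bounded linear operator $S$ from a Hilbert space $H$ to a Hilbert space $K$ is called absolutely minimum attaining (AM) if for every nonzero closed subspace $M \subseteq H$ there is a unit vector $x_0 \in M$ with $\|Sx_0\| = \inf\{\|Sx\| : x \in M,\ \|x\| = 1\}$. For a bounded operator $S$ on $H$, let $\sigma_{\mathrm{ess}}(S)$ be the set of all $\mu \in \mathbb{C}$ such that $S - \mu I$ is not a Fredholm operator. Let $A$ be a positive bounded operator on $H_1$ (that is, $\langle Ax, x\rangle \ge 0$ for all $x$), let $X : H_2 \to H_1$ be a bounded linear operator, and suppose that the block operator $$T = \begin{bmatrix} A & X \\ X^* & I_{H_2} \end{bmatrix}$$ on the Hilbert space direct sum $H_1 \oplus H_2$ is positive. Then $T$ is AM if and only if $A$ is AM, $\sigma_{\mathrm{ess}}(A) = \{1\}$ and $X$ has finite rank. -/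

import Mathlib

open scoped InnerProductSpace

noncomputable section

namespace BlockAM

section MinimumModulus

variable {E F : Type*} [NormedAddCommGroup E] [NormedSpace ℂ E]
  [NormedAddCommGroup F] [NormedSpace ℂ F]

/-- The minimum modulus `m(T) = inf {‖T x‖ : ‖x‖ = 1}`. -/
def minimumModulus (T : E →L[ℂ] F) : ℝ :=
  sInf {r : ℝ | ∃ x : E, ‖x‖ = 1 ∧ ‖T x‖ = r}

/-- `T` attains its minimum modulus at some unit vector. -/
def IsMinimumAttaining (T : E →L[ℂ] F) : Prop :=
  ∃ x : E, ‖x‖ = 1 ∧ ‖T x‖ = minimumModulus T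

/-- `T` is absolutely minimum attaining (`AM`): the restriction of `T` to every nonzero closed
subspace `M` of its domain is minimum attaining. -/
def IsAbsolutelyMinimumAttaining (T : E →L[ℂ] F) : Prop :=
  ∀ M : Submodule ℂ E, IsClosed (M : Set E) → M ≠ ⊥ → IsMinimumAttaining (T ∘L M.subtypeL)

/-- The essential spectrum: the set of all `μ ∈ ℂ` such that `T - μ I` is not Fredholm. -/
def essentialSpectrum (T : E →L[ℂ] E) : Set ℂ :=
  {μ : ℂ | ¬ (T - μ • ContinuousLinearMap.id ℂ E).IsFredholm}

/-- `T` has finite rank: its range is finite-dimensional. -/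
def IsFiniteRank (T : E →L[ℂ] F) : Prop :=
  FiniteDimensional ℂ (T : E →ₗ[ℂ] F).range

end MinimumModulus

section Block

variable {H₁ H₂ : Type*} [NormedAddCommGroup H₁] [InnerProductSpace ℂ H₁]
  [NormedAddCommGroup H₂] [InnerProductSpace ℂ H₂]

/-- The operator on the Hilbert space direct sum `H₁ ⊕ H₂` with block matrix
`[[A₁₁, A₁₂], [A₂₁, A₂₂]]`, that is, `(x, y) ↦ (A₁₁ x + A₁₂ y, A₂₁ x + A₂₂ y)`. -/
def blockOperator (A₁₁ : H₁ →L[ℂ] H₁) (A₁₂ : H₂ →L[ℂ] H₁) (A₂₁ : H₁ →L[ℂ] H₂)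
    (A₂₂ : H₂ →L[ℂ] H₂) : WithLp 2 (H₁ × H₂) →L[ℂ] WithLp 2 (H₁ × H₂) :=
  ((WithLp.prodContinuousLinearEquiv 2 ℂ H₁ H₂).symm : H₁ × H₂ →L[ℂ] WithLp 2 (H₁ × H₂)) ∘L
    ((A₁₁.coprod A₁₂).prod (A₂₁.coprod A₂₂)) ∘L
    (WithLp.prodContinuousLinearEquiv 2 ℂ H₁ H₂ : WithLp 2 (H₁ × H₂) →L[ℂ] H₁ × H₂)

theorem blockOperator_apply (A₁₁ : H₁ →L[ℂ] H₁) (A₁₂ : H₂ →L[ℂ] H₁) (A₂₁ : H₁ →L[ℂ] H₂)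
    (A₂₂ : H₂ →L[ℂ] H₂) (v : WithLp 2 (H₁ × H₂)) :
    blockOperator A₁₁ A₁₂ A₂₁ A₂₂ v =
      WithLp.toLp 2 (A₁₁ v.fst + A₁₂ v.snd, A₂₁ v.fst + A₂₂ v.snd) := rfl

end Block

end BlockAM

end

/-! A positive operator on an infinite-dimensional Hilbert space is AM exactly when it equals `β - K
+ G` with `K` positive compact and `G` of finite rank; `β` is then its only essential spectral
value. The theorem is this characterization read off blockwise.

Sufficiency (`isAbsolutelyMinimumAttaining_of_eq`): let `S` be the restriction to `M`, with minimum
modulus `m`. If `m ≠ β`, then `S⋆S - m²` is a nonzero scalar plus a compact operator, so minimizing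
sequences have convergent subsequences. If `m = β` and `M` is infinite-dimensional, a unit vector of
`M` killed by `G` and `GK` already satisfies `‖Tx‖ ≤ β`.

Necessity (`exists_eq_sub_add`): minimizers on invariant subspaces are eigenvectors, so the operator
is diagonalizable. Testing AM on spans of suitable combinations of eigenvectors shows that the
eigenvalues converge to some `β`, with only finitely many above it.

For the block operator, the identity corner forces `β = 1`, so the lower right corner of `K` equals
that of `G` and has finite rank. Positivity of `K` then makes its whole second column finite rank,
hence also `X`. Conversely, finite rank off-diagonal blocks are absorbed into `G`. -/

namespace BlockAM

open ContinuousLinearMap Filter Topology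

/-! ### Finite rank operators -/

section FiniteRank

variable {E F G : Type*} [NormedAddCommGroup E] [NormedSpace ℂ E]
  [NormedAddCommGroup F] [NormedSpace ℂ F] [NormedAddCommGroup G] [NormedSpace ℂ G]

theorem isFiniteRank_iff_hasFiniteRange {T : E →L[ℂ] F} :
    IsFiniteRank T ↔ (T : E →ₗ[ℂ] F).HasFiniteRange :=
  Submodule.fg_iff_finiteDimensional _ |>.symm

theorem IsFiniteRank.add {S T : E →L[ℂ] F} (hS : IsFiniteRank S) (hT : IsFiniteRank T) :
    IsFiniteRank (S + T) := by
  rw [isFiniteRank_iff_hasFiniteRange] at *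
  exact hS.add hT

theorem IsFiniteRank.sub {S T : E →L[ℂ] F} (hS : IsFiniteRank S) (hT : IsFiniteRank T) :
    IsFiniteRank (S - T) := by
  rw [isFiniteRank_iff_hasFiniteRange] at *
  exact hS.sub hT

theorem IsFiniteRank.clm_comp {T : E →L[ℂ] F} (hT : IsFiniteRank T) (S : F →L[ℂ] G) :
    IsFiniteRank (S ∘L T) := by
  rw [isFiniteRank_iff_hasFiniteRange] at *
  exact hT.comp_left (S : F →ₗ[ℂ] G)

theorem IsFiniteRank.comp_clm {T : F →L[ℂ] G} (hT : IsFiniteRank T) (S : E →L[ℂ] F) :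
    IsFiniteRank (T ∘L S) := by
  rw [isFiniteRank_iff_hasFiniteRange] at *
  exact hT.comp_right (S : E →ₗ[ℂ] F)

/-- Finite rank passes to every operator with a larger kernel. -/
theorem IsFiniteRank.of_ker_le {S : E →L[ℂ] F} {T : E →L[ℂ] G} (hT : IsFiniteRank T)
    (h : ∀ x, T x = 0 → S x = 0) : IsFiniteRank S := by
  rw [isFiniteRank_iff_hasFiniteRange, ← LinearMap.ker_coFG_iff_hasFiniteRange] at *
  exact hT.of_le fun x hx => h x hx

theorem IsFiniteRank.isCompactOperator {T : E →L[ℂ] F} (hT : IsFiniteRank T) :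
    IsCompactOperator T := by
  have : FiniteDimensional ℂ (T : E →ₗ[ℂ] F).range := hT
  have : ProperSpace (T : E →ₗ[ℂ] F).range := FiniteDimensional.proper ℂ _
  have h : IsCompactOperator (T.codRestrict (T : E →ₗ[ℂ] F).range fun x => ⟨x, rfl⟩) :=
    isCompactOperator_of_locallyCompactSpace_dom _
  exact h.clm_comp (T : E →ₗ[ℂ] F).range.subtypeL

/-- A finite rank operator on an infinite-dimensional space has a unit vector in its kernel. -/
theorem IsFiniteRank.exists_norm_eq_one {T : E →L[ℂ] F} (hT : IsFiniteRank T)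
    (hE : ¬ FiniteDimensional ℂ E) : ∃ x : E, ‖x‖ = 1 ∧ T x = 0 := by
  have hker : (T : E →ₗ[ℂ] F).ker ≠ ⊥ := by
    intro h
    refine hE ?_
    have : FiniteDimensional ℂ (T : E →ₗ[ℂ] F).range := hT
    exact (LinearEquiv.ofInjective (T : E →ₗ[ℂ] F) (LinearMap.ker_eq_bot.1 h)).symm.finiteDimensional
  obtain ⟨x, hx, hx0⟩ := Submodule.exists_mem_ne_zero_of_ne_bot hker
  have hx' : T x = 0 := hx
  refine ⟨((‖x‖⁻¹ : ℝ) : ℂ) • x, ?_, by rw [map_smul, hx', smul_zero]⟩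
  rw [norm_smul, Complex.norm_real, norm_inv, norm_norm, inv_mul_cancel₀ (norm_ne_zero_iff.2 hx0)]

theorem IsFiniteRank.prod {S : E →L[ℂ] F} {T : E →L[ℂ] G} (hS : IsFiniteRank S)
    (hT : IsFiniteRank T) : IsFiniteRank (S.prod T) := by
  have h : S.prod T = inl ℂ F G ∘L S + inr ℂ F G ∘L T := by ext x <;> simp
  rw [h]
  exact (hS.clm_comp _).add (hT.clm_comp _)

end FiniteRank

/-! ### Compact perturbations of scalars and the essential spectrum -/

section Compact

variable {E : Type*} [NormedAddCommGroup E] [InnerProductSpace ℂ E]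

theorem isFiniteRank_starProjection (V : Submodule ℂ E) [FiniteDimensional ℂ V] :
    IsFiniteRank V.starProjection := by
  have h : (V.starProjection : E →ₗ[ℂ] E).range = V := Submodule.range_starProjection V
  rw [IsFiniteRank, h]
  infer_instance

/-- The adjoint vanishes on the orthogonal complement of the range of `T`, which is the kernel of a
finite rank projection. -/
theorem IsFiniteRank.adjoint {F : Type*} [NormedAddCommGroup F] [InnerProductSpace ℂ F]
    [CompleteSpace E] [CompleteSpace F] {T : E →L[ℂ] F} (hT : IsFiniteRank T) :
    IsFiniteRank (ContinuousLinearMap.adjoint T) := by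
  let V := (T : E →ₗ[ℂ] F).range
  have : FiniteDimensional ℂ V := hT
  refine (isFiniteRank_starProjection V).of_ker_le fun x hx => ?_
  rw [Submodule.starProjection_apply_eq_zero_iff] at hx
  refine ext_inner_left ℂ fun z => ?_
  rw [adjoint_inner_right, inner_zero_right]
  exact (Submodule.mem_orthogonal V x).1 hx (T z) ⟨z, rfl⟩

/-- A compact operator into an inner product space is a norm limit of finite rank operators. -/
theorem exists_isFiniteRank_norm_sub_lt {C : E →L[ℂ] E} (hC : IsCompactOperator C) {ε : ℝ}
    (hε : 0 < ε) : ∃ F : E →L[ℂ] E, IsFiniteRank F ∧ ‖C - F‖ < ε := by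
  obtain ⟨t, ht, hsub⟩ := Metric.totallyBounded_iff.1
    (hC.isCompact_closure_image_closedBall 1).totallyBounded (ε / 2) (half_pos hε)
  -- Projecting onto the span of an `ε / 2`-net moves no point of the image of the unit ball by more
  -- than `ε / 2`.
  let V := Submodule.span ℂ t
  have : FiniteDimensional ℂ V := FiniteDimensional.span_of_finite ℂ ht
  refine ⟨V.starProjection ∘L C, (isFiniteRank_starProjection V).comp_clm C, ?_⟩
  · refine lt_of_le_of_lt ?_ (half_lt_self hε)
    refine opNorm_le_of_unit_norm (half_pos hε).le fun x hx => ?_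
    have hmem := hsub (subset_closure ⟨x, by simp [hx], rfl⟩)
    simp only [Set.mem_iUnion, Metric.mem_ball, exists_prop] at hmem
    obtain ⟨y, hy, hxy⟩ := hmem
    have h1 : ‖C x - V.starProjection (C x)‖ ≤ ‖C x - y‖ := by
      rw [Submodule.starProjection_minimal]
      exact ciInf_le ⟨0, by rintro _ ⟨w, rfl⟩; exact norm_nonneg _⟩
        (⟨y, Submodule.subset_span hy⟩ : V)
    rw [dist_eq_norm] at hxy
    exact h1.trans hxy.le

/-- A nonzero multiple of the identity plus a compact operator is Fredholm. -/
theorem isFredholm_smul_id_add [CompleteSpace E] {C : E →L[ℂ] E} (hC : IsCompactOperator C)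
    {c : ℂ} (hc : c ≠ 0) : (c • ContinuousLinearMap.id ℂ E + C).IsFredholm := by
  -- With `‖C - F‖ < ‖c‖`, the operator `c + (C - F)` is invertible by a Neumann series; its inverse
  -- is a quasi-inverse of `c + C`.
  obtain ⟨F, hF, hCF⟩ := exists_isFiniteRank_norm_sub_lt hC (norm_pos_iff.2 hc)
  have hD : ‖-(c⁻¹ • (C - F))‖ < 1 := by
    rw [norm_neg, norm_smul, norm_inv, inv_mul_lt_one₀ (norm_pos_iff.2 hc)]
    exact hCF
  obtain ⟨u, hu⟩ : IsUnit (c • ContinuousLinearMap.id ℂ E + (C - F)) := by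
    have h : c • ContinuousLinearMap.id ℂ E + (C - F) =
        Units.mk0 c hc • (1 - -(c⁻¹ • (C - F))) := by
      ext x
      simp [Units.smul_def, smul_smul, hc]
    rw [h]
    exact (isUnit_one_sub_of_norm_lt_one hD).smul _
  have hdecomp : c • ContinuousLinearMap.id ℂ E + C = u + F := by rw [hu]; abel
  rw [hdecomp]
  refine IsFredholm.of_isQuasiInverse (v := (↑u⁻¹ : E →L[ℂ] E)) ⟨?_, ?_⟩
  · refine LinearMap.FiniteRangeSetoid.equiv_iff_hasFiniteRange.2 ?_
    have h : ((↑u⁻¹ : E →L[ℂ] E) : E →ₗ[ℂ] E) ∘ₗ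
        (((u : E →L[ℂ] E) + F : E →L[ℂ] E) : E →ₗ[ℂ] E) - LinearMap.id = ((↑u⁻¹ : E →L[ℂ] E) : E →ₗ[ℂ] E) ∘ₗ (F : E →ₗ[ℂ] E) := by
      refine LinearMap.ext fun x => ?_
      have := DFunLike.congr_fun u.inv_mul x
      simp only [mul_apply_eq_comp, one_apply_eq_self] at this
      simp [this]
    exact h ▸ isFiniteRank_iff_hasFiniteRange.1 (hF.clm_comp (↑u⁻¹ : E →L[ℂ] E))
  · refine LinearMap.FiniteRangeSetoid.equiv_iff_hasFiniteRange.2 ?_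
    have h : (((u : E →L[ℂ] E) + F : E →L[ℂ] E) : E →ₗ[ℂ] E) ∘ₗ
        ((↑u⁻¹ : E →L[ℂ] E) : E →ₗ[ℂ] E) - LinearMap.id = (F : E →ₗ[ℂ] E) ∘ₗ ((↑u⁻¹ : E →L[ℂ] E) : E →ₗ[ℂ] E) := by
      refine LinearMap.ext fun x => ?_
      have := DFunLike.congr_fun u.mul_inv x
      simp only [mul_apply_eq_comp, one_apply_eq_self] at this
      simp [this]
    exact h ▸ isFiniteRank_iff_hasFiniteRange.1 (hF.comp_clm (↑u⁻¹ : E →L[ℂ] E))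

/-- The essential spectrum is invariant under compact perturbation of a scalar operator. -/
theorem essentialSpectrum_smul_id_add [CompleteSpace E] (hE : ¬ FiniteDimensional ℂ E)
    {C : E →L[ℂ] E} (hC : IsCompactOperator C) (c : ℂ) :
    essentialSpectrum (c • ContinuousLinearMap.id ℂ E + C) = {c} := by
  ext μ
  have hsub : c • ContinuousLinearMap.id ℂ E + C - μ • ContinuousLinearMap.id ℂ E =
      (c - μ) • ContinuousLinearMap.id ℂ E + C := by
    rw [sub_smul]; abel
  rw [essentialSpectrum, Set.mem_ofPred_eq, hsub, Set.mem_singleton_iff]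
  refine ⟨fun h => ?_, ?_⟩
  · by_contra hne
    exact h (isFredholm_smul_id_add hC (sub_ne_zero.2 (Ne.symm hne)))
  -- At `μ = c` the operator `C` itself would be Fredholm; being compact and invertible modulo
  -- finite rank, it would make the identity compact.
  · rintro rfl hfred
    rw [sub_self, zero_smul, zero_add] at hfred
    obtain ⟨v, hv⟩ := hfred.exists_isQuasiInverse
    have h1 : IsFiniteRank (v ∘L C - ContinuousLinearMap.id ℂ E) := by
      rw [isFiniteRank_iff_hasFiniteRange]
      exact LinearMap.FiniteRangeSetoid.equiv_iff_hasFiniteRange.1 hv.1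
    have h2 : IsCompactOperator (ContinuousLinearMap.id ℂ E) := by
      have h3 : ⇑(ContinuousLinearMap.id ℂ E) =
          ⇑v ∘ ⇑C - ⇑(v ∘L C - ContinuousLinearMap.id ℂ E) := by
        funext x
        simp
      rw [h3]
      exact (hC.clm_comp v).sub h1.isCompactOperator
    exact hE (FiniteDimensional.of_isCompactOperator_id (𝕜 := ℂ) h2)

end Compact

/-! ### Quadratic forms of positive operators -/

section Positive

variable {E : Type*} [NormedAddCommGroup E] [InnerProductSpace ℂ E] [CompleteSpace E]

theorem exists_eq_adjoint_comp {B : E →L[ℂ] E} (hB : B.IsPositive) :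
    ∃ R : E →L[ℂ] E, B = adjoint R ∘L R :=
  CStarAlgebra.nonneg_iff_eq_star_mul_self.1 ((nonneg_iff_isPositive B).2 hB)

theorem re_inner_adjoint_comp_self (R : E →L[ℂ] E) (x : E) :
    (⟪(adjoint R ∘L R) x, x⟫_ℂ).re = ‖R x‖ ^ 2 := by
  rw [ContinuousLinearMap.comp_apply, adjoint_inner_left, inner_self_eq_norm_sq_to_K]
  norm_cast

/-- `‖B x‖²` is controlled by the quadratic form of a positive operator `B`. -/
theorem exists_norm_sq_le_re_inner {B : E →L[ℂ] E} (hB : B.IsPositive) :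
    ∃ a : ℝ, ∀ x, ‖B x‖ ^ 2 ≤ a * (⟪B x, x⟫_ℂ).re := by
  obtain ⟨R, rfl⟩ := exists_eq_adjoint_comp hB
  refine ⟨‖adjoint R‖ ^ 2, fun x => ?_⟩
  rw [re_inner_adjoint_comp_self, ← mul_pow]
  exact pow_le_pow_left₀ (norm_nonneg _) ((adjoint R).le_opNorm _) 2

theorem apply_eq_zero_of_re_inner_eq_zero {B : E →L[ℂ] E} (hB : B.IsPositive) {x : E}
    (hx : (⟪B x, x⟫_ℂ).re = 0) : B x = 0 := by
  obtain ⟨a, ha⟩ := exists_norm_sq_le_re_inner hB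
  have h := ha x
  rw [hx, mul_zero] at h
  exact norm_eq_zero.1 (pow_eq_zero_iff two_ne_zero |>.1 (le_antisymm h (sq_nonneg _)))

/-- The Cauchy–Schwarz inequality for the form of a positive operator, at `x` and `K x`. -/
theorem norm_pow_four_le {K : E →L[ℂ] E} (hK : K.IsPositive) (x : E) :
    ‖K x‖ ^ 4 ≤ (⟪K x, x⟫_ℂ).re * (⟪K (K x), K x⟫_ℂ).re := by
  obtain ⟨R, hR⟩ := exists_eq_adjoint_comp hK
  have h1 : ∀ y, (⟪K y, y⟫_ℂ).re = ‖R y‖ ^ 2 := fun y => by rw [hR, re_inner_adjoint_comp_self]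
  have h2 : ‖K x‖ ^ 2 ≤ ‖R x‖ * ‖R (K x)‖ := by
    have h3 : ⟪K x, K x⟫_ℂ = ⟪R x, R (K x)⟫_ℂ := by
      conv_lhs => lhs; rw [hR]
      rw [ContinuousLinearMap.comp_apply, adjoint_inner_left]
    have h4 := norm_inner_le_norm (𝕜 := ℂ) (R x) (R (K x))
    rw [← h3, inner_self_eq_norm_sq_to_K] at h4
    simpa using h4
  rw [h1, h1]
  calc ‖K x‖ ^ 4 = (‖K x‖ ^ 2) ^ 2 := by ring
    _ ≤ (‖R x‖ * ‖R (K x)‖) ^ 2 := pow_le_pow_left₀ (sq_nonneg _) h2 2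
    _ = _ := by ring

end Positive

/-! ### The minimum modulus -/

section MinimumModulusBounds

variable {E F : Type*} [NormedAddCommGroup E] [NormedSpace ℂ E]
  [NormedAddCommGroup F] [NormedSpace ℂ F]

theorem minimumModulus_nonneg (T : E →L[ℂ] F) : 0 ≤ minimumModulus T := by
  refine Real.sInf_nonneg ?_
  rintro _ ⟨x, -, rfl⟩
  exact norm_nonneg _

theorem minimumModulus_le (T : E →L[ℂ] F) {x : E} (hx : ‖x‖ = 1) : minimumModulus T ≤ ‖T x‖ := by
  refine csInf_le ⟨0, ?_⟩ ⟨x, hx, rfl⟩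
  rintro _ ⟨x, -, rfl⟩
  exact norm_nonneg _

theorem minimumModulus_mul_norm_le (T : E →L[ℂ] F) (x : E) :
    minimumModulus T * ‖x‖ ≤ ‖T x‖ := by
  rcases eq_or_ne x 0 with rfl | hx
  · simp
  have hx' : 0 < ‖x‖ := norm_pos_iff.2 hx
  have h := minimumModulus_le T (x := ((‖x‖⁻¹ : ℝ) : ℂ) • x) (by
    rw [norm_smul, Complex.norm_real, norm_inv, norm_norm, inv_mul_cancel₀ hx'.ne'])
  rw [map_smul, norm_smul, Complex.norm_real, norm_inv, norm_norm] at h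
  rwa [← le_div_iff₀ hx', div_eq_inv_mul]

theorem exists_seq_tendsto_minimumModulus [Nontrivial E] (T : E →L[ℂ] F) :
    ∃ x : ℕ → E, (∀ n, ‖x n‖ = 1) ∧ Tendsto (fun n => ‖T (x n)‖) atTop (𝓝 (minimumModulus T)) := by
  obtain ⟨x₀, hx₀⟩ := exists_norm_eq E zero_le_one
  obtain ⟨r, -, hr, hmem⟩ := exists_seq_tendsto_sInf
    (S := {r : ℝ | ∃ x : E, ‖x‖ = 1 ∧ ‖T x‖ = r}) ⟨_, x₀, hx₀, rfl⟩
    ⟨0, by rintro _ ⟨x, -, rfl⟩; exact norm_nonneg _⟩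
  choose x hx hxr using hmem
  exact ⟨x, hx, by simpa only [hxr, minimumModulus] using! hr⟩

end MinimumModulusBounds

/-! ### Sufficiency: operators `β - K + G` are AM -/

section Hilbert

variable {E F : Type*} [NormedAddCommGroup E] [InnerProductSpace ℂ E] [CompleteSpace E]
  [NormedAddCommGroup F] [InnerProductSpace ℂ F] [CompleteSpace F]

/-- The gap `S⋆S - m(S)²`. -/
noncomputable def minimumGap (S : E →L[ℂ] F) : E →L[ℂ] E :=
  adjoint S ∘L S - ((minimumModulus S ^ 2 : ℝ) : ℂ) • ContinuousLinearMap.id ℂ E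

theorem inner_minimumGap (S : E →L[ℂ] F) (x y : E) :
    ⟪minimumGap S x, y⟫_ℂ = ⟪S x, S y⟫_ℂ - ((minimumModulus S ^ 2 : ℝ) : ℂ) * ⟪x, y⟫_ℂ := by
  simp [minimumGap, adjoint_inner_left, mul_comm]

theorem re_inner_minimumGap_self (S : E →L[ℂ] F) (x : E) :
    (⟪minimumGap S x, x⟫_ℂ).re = ‖S x‖ ^ 2 - minimumModulus S ^ 2 * ‖x‖ ^ 2 := by
  rw [inner_minimumGap, inner_self_eq_norm_sq_to_K, inner_self_eq_norm_sq_to_K]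
  simp [← Complex.ofReal_pow]

theorem isPositive_minimumGap (S : E →L[ℂ] F) : (minimumGap S).IsPositive := by
  rw [isPositive_def']
  refine ⟨?_, fun x => ?_⟩
  · rw [isSelfAdjoint_iff_isSymmetric]
    intro x y
    have h := inner_minimumGap S y x
    have h2 : ⟪x, minimumGap S y⟫_ℂ = starRingEnd ℂ ⟪minimumGap S y, x⟫_ℂ :=
      (inner_conj_symm _ _).symm
    change ⟪minimumGap S x, y⟫_ℂ = ⟪x, minimumGap S y⟫_ℂ
    rw [h2, h, inner_minimumGap, map_sub, map_mul, inner_conj_symm, inner_conj_symm,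
      Complex.conj_ofReal]
  · change 0 ≤ (⟪minimumGap S x, x⟫_ℂ).re
    rw [re_inner_minimumGap_self, sub_nonneg, ← mul_pow]
    exact pow_le_pow_left₀ (mul_nonneg (minimumModulus_nonneg S) (norm_nonneg x))
      (minimumModulus_mul_norm_le S x) 2

/-- At a minimizing unit vector the gap operator vanishes. -/
theorem minimumGap_apply_eq_zero {S : E →L[ℂ] F} {x : E} (hx : ‖x‖ = 1)
    (hSx : ‖S x‖ = minimumModulus S) : minimumGap S x = 0 := by
  refine apply_eq_zero_of_re_inner_eq_zero (isPositive_minimumGap S) ?_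
  rw [re_inner_minimumGap_self, hx, hSx]
  ring

/-- If `S⋆S` is a compact perturbation of a scalar other than `m(S)²`, then `S` attains its
minimum modulus. -/
theorem isMinimumAttaining_of_adjoint_comp_self [Nontrivial E] (S : E →L[ℂ] F) {C : E →L[ℂ] E}
    (hC : IsCompactOperator C) {c : ℝ}
    (hS : adjoint S ∘L S = (c : ℂ) • ContinuousLinearMap.id ℂ E + C)
    (hc : minimumModulus S ^ 2 ≠ c) : IsMinimumAttaining S := by
  obtain ⟨x, hx, hxm⟩ := exists_seq_tendsto_minimumModulus S
  set m := minimumModulus S with hm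
  -- The form of the positive gap operator tends to zero along a minimizing sequence, hence so do
  -- its values.
  have hgap : Tendsto (fun n => minimumGap S (x n)) atTop (𝓝 0) := by
    obtain ⟨a, ha⟩ := exists_norm_sq_le_re_inner (isPositive_minimumGap S)
    have h1 : Tendsto (fun n => a * (⟪minimumGap S (x n), x n⟫_ℂ).re) atTop (𝓝 0) := by
      have h2 : Tendsto (fun n => a * (‖S (x n)‖ ^ 2 - m ^ 2)) atTop (𝓝 (a * (m ^ 2 - m ^ 2))) :=
        ((hxm.pow 2).sub_const _).const_mul a
      simpa [re_inner_minimumGap_self, hx] using h2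
    have h3 : Tendsto (fun n => ‖minimumGap S (x n)‖ ^ 2) atTop (𝓝 0) :=
      squeeze_zero (fun n => sq_nonneg _) (fun n => ha (x n)) h1
    have h4 := h3.sqrt
    simp only [Real.sqrt_sq (norm_nonneg _), Real.sqrt_zero] at h4
    exact tendsto_zero_iff_norm_tendsto_zero.2 h4
  obtain ⟨k, hk, hCk⟩ := hC.image_closedBall_subset_compact 1
  obtain ⟨y, -, φ, hφ, hy⟩ := hk.tendsto_subseq
    (x := fun n => C (x n)) (fun n => hCk ⟨x n, by simp [hx], rfl⟩)
  let d : ℂ := ((c - m ^ 2 : ℝ) : ℂ)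
  have hd : d ≠ 0 := Complex.ofReal_ne_zero.2 (sub_ne_zero.2 (Ne.symm hc))
  -- Solve `minimumGap S x - C x = (c - m²) x` for `x`: both terms on the left converge along the
  -- subsequence.
  have hlim : Tendsto (fun n => x (φ n)) atTop (𝓝 (d⁻¹ • (0 - y))) := by
    refine (((hgap.comp hφ.tendsto_atTop).sub hy).const_smul d⁻¹).congr fun n => ?_
    have : minimumGap S (x (φ n)) - C (x (φ n)) = d • x (φ n) := by
      simp only [minimumGap, hS, d, ← hm, sub_apply, add_apply, smul_apply,
        ContinuousLinearMap.id_apply, Complex.ofReal_sub, sub_smul]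
      abel
    simp only [Function.comp_apply, this, smul_smul, inv_mul_cancel₀ hd, one_smul]
  refine ⟨d⁻¹ • (0 - y), ?_, ?_⟩
  · exact tendsto_nhds_unique hlim.norm (by simp [hx])
  · exact tendsto_nhds_unique ((S.continuous.tendsto _).comp hlim).norm
      (hxm.comp hφ.tendsto_atTop)

/-- A positive operator of the form `β - K + F` with `K` positive compact and `F` of finite rank
is absolutely minimum attaining. -/
theorem isAbsolutelyMinimumAttaining_of_eq {T K G : E →L[ℂ] E} {β : ℝ} (hβ : 0 ≤ β)
    (hT : T.IsPositive) (hK : K.IsPositive) (hKc : IsCompactOperator K) (hG : IsFiniteRank G)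
    (hTKG : T = (β : ℂ) • ContinuousLinearMap.id ℂ E - K + G) :
    IsAbsolutelyMinimumAttaining T := by
  intro M hM hM0
  have : CompleteSpace M := hM.completeSpace_coe
  have : Nontrivial M := Submodule.nontrivial_iff_ne_bot.2 hM0
  set S := T ∘L M.subtypeL with hS
  by_cases hfin : FiniteDimensional ℂ M
  -- In finite dimension every operator is compact, and any negative `c` differs from `m²`.
  · have : ProperSpace M := FiniteDimensional.proper ℂ M
    refine isMinimumAttaining_of_adjoint_comp_self S (c := -1)
      (C := adjoint S ∘L S + ContinuousLinearMap.id ℂ M)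
      (isCompactOperator_of_locallyCompactSpace_dom _) ?_ ?_
    · simp
    · nlinarith [sq_nonneg (minimumModulus S)]
  obtain ⟨x, hx, hGx⟩ := ((hG.prod (hG.comp_clm K)).comp_clm M.subtypeL).exists_norm_eq_one hfin
  have hx1 : G x = 0 := congr_arg Prod.fst hGx
  have hx2 : G (K x) = 0 := congr_arg Prod.snd hGx
  have hbound : ‖S x‖ ≤ β := by
    have hTx : S x = (β : ℂ) • (x : E) - K x := by simp [hS, hTKG, hx1]
    -- Positivity of `T` at `K x`, where `G` vanishes.
    have hKK : (⟪K (K x), K x⟫_ℂ).re ≤ β * ‖K x‖ ^ 2 := by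
      have h := hT.re_inner_nonneg_left (K x)
      have h' : T (K x) = (β : ℂ) • K x - K (K x) := by simp [hTKG, hx2]
      rw [h', inner_sub_left, inner_smul_left, inner_self_eq_norm_sq_to_K] at h
      have h2 : (starRingEnd ℂ (β : ℂ) * ((‖K x‖ : ℂ)) ^ 2) = ((β * ‖K x‖ ^ 2 : ℝ) : ℂ) := by
        simp
      change 0 ≤ (starRingEnd ℂ (β : ℂ) * ((‖K x‖ : ℂ)) ^ 2 - _ : ℂ).re at h
      rw [h2, Complex.sub_re, Complex.ofReal_re] at h
      linarith
    have hq0 : 0 ≤ (⟪K x, (x : E)⟫_ℂ).re := hK.re_inner_nonneg_left _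
    have hKx : ‖K x‖ ^ 2 ≤ β * (⟪K x, (x : E)⟫_ℂ).re := by
      rcases eq_or_ne (K x) 0 with h0 | h0
      · rw [h0, norm_zero]; simp
      have h4 := (norm_pow_four_le hK (x : E)).trans (mul_le_mul_of_nonneg_left hKK hq0)
      have hpos : 0 < ‖K x‖ ^ 2 := pow_pos (norm_pos_iff.2 h0) 2
      nlinarith
    -- With `q = ⟪K x, x⟫`: `‖β x - K x‖² = β² - 2 β q + ‖K x‖² ≤ β² - β q ≤ β²`.
    refine le_of_sq_le_sq ?_ hβ
    rw [hTx, @norm_sub_sq ℂ, norm_smul, inner_smul_left, Complex.norm_real, Real.norm_of_nonneg hβ]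
    have hre : RCLike.re (starRingEnd ℂ (β : ℂ) * ⟪(x : E), K x⟫_ℂ) =
        β * (⟪K x, (x : E)⟫_ℂ).re := by
      rw [← inner_conj_symm, ← map_mul]
      change (starRingEnd ℂ ((β : ℂ) * ⟪K x, (x : E)⟫_ℂ)).re = _
      rw [Complex.conj_re, Complex.re_ofReal_mul]
    have hx' : ‖(x : E)‖ = 1 := hx
    rw [hre, hx']
    nlinarith
  rcases eq_or_ne (minimumModulus S) β with h | h
  · exact ⟨x, hx, le_antisymm (h ▸ hbound) (minimumModulus_le S hx)⟩
  let C := G - K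
  have hC : IsCompactOperator C := hG.isCompactOperator.sub hKc
  have hTC : T = (β : ℂ) • ContinuousLinearMap.id ℂ E + C := by rw [hTKG]; simp only [C]; abel
  have hTT : adjoint T ∘L T = ((β ^ 2 : ℝ) : ℂ) • ContinuousLinearMap.id ℂ E +
      ((2 * β : ℂ) • C + C ∘L C) := by
    rw [hT.isSelfAdjoint.adjoint_eq, hTC]
    ext y
    simp only [comp_apply, add_apply, smul_apply, ContinuousLinearMap.id_apply, map_add, map_smul]
    push_cast
    module
  refine isMinimumAttaining_of_adjoint_comp_self S (c := β ^ 2)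
    (C := adjoint M.subtypeL ∘L ((2 * β : ℂ) • C + C ∘L C) ∘L M.subtypeL) ?_ ?_ ?_
  · have h1 : IsCompactOperator ((2 * β : ℂ) • C + C ∘L C) :=
      (hC.smul (2 * β : ℂ)).add (hC.comp_clm C)
    exact (h1.comp_clm M.subtypeL).clm_comp (adjoint M.subtypeL)
  · rw [hS, adjoint_comp, ContinuousLinearMap.comp_assoc,
      ← ContinuousLinearMap.comp_assoc (adjoint T), hTT]
    ext y
    have hy : adjoint M.subtypeL (y : E) = y := by
      refine ext_inner_right ℂ fun z => ?_
      rw [adjoint_inner_left]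
      rfl
    simp [hy]
  · rw [Ne, sq_eq_sq₀ (minimumModulus_nonneg S) hβ]
    exact h

end Hilbert

/-! ### Necessity: minimizers and diagonalization -/

section Minimizers

variable {E F : Type*} [NormedAddCommGroup E] [InnerProductSpace ℂ E] [CompleteSpace E]
  [NormedAddCommGroup F] [InnerProductSpace ℂ F] [CompleteSpace F]

/-- A minimizer on a closed subspace, with its first order condition. -/
theorem IsAbsolutelyMinimumAttaining.exists_minimizer {T : E →L[ℂ] F}
    (hT : IsAbsolutelyMinimumAttaining T) {M : Submodule ℂ E} (hM : IsClosed (M : Set E))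
    (hM0 : M ≠ ⊥) : ∃ m : ℝ, 0 ≤ m ∧ (∀ v ∈ M, m * ‖v‖ ≤ ‖T v‖) ∧
      ∃ x ∈ M, ‖x‖ = 1 ∧ ‖T x‖ = m ∧ ∀ v ∈ M, ⟪T x, T v⟫_ℂ = ((m ^ 2 : ℝ) : ℂ) * ⟪x, v⟫_ℂ := by
  have : CompleteSpace M := hM.completeSpace_coe
  obtain ⟨x, hx, hxm⟩ := hT M hM hM0
  set S := T ∘L M.subtypeL
  refine ⟨minimumModulus S, minimumModulus_nonneg S,
    fun v hv => minimumModulus_mul_norm_le S ⟨v, hv⟩, x, x.2, hx, hxm, fun v hv => ?_⟩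
  have h := inner_minimumGap S x ⟨v, hv⟩
  rw [minimumGap_apply_eq_zero hx hxm, inner_zero_left] at h
  exact (sub_eq_zero.1 h.symm)

/-- On the closed span of vectors `g i` with `⟪T gᵢ, T gⱼ⟫ = tᵢ ⟪gᵢ, gⱼ⟫`, the infimum of the
`t i` has to be attained. -/
theorem IsAbsolutelyMinimumAttaining.not_forall_lt {T : E →L[ℂ] F}
    (hT : IsAbsolutelyMinimumAttaining T) {ι : Type*} [Nonempty ι] {g : ι → E} {t : ι → ℝ}
    (hg : ∀ i, g i ≠ 0) (hTg : ∀ i j, ⟪T (g i), T (g j)⟫_ℂ = (t i : ℂ) * ⟪g i, g j⟫_ℂ)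
    {a : ℝ} (hinf : ∀ ε > 0, ∃ i, t i < a + ε) : ¬ ∀ i, a < t i := by
  intro hlt
  set M := (Submodule.span ℂ (Set.range g)).topologicalClosure with hMdef
  have hMc : IsClosed (M : Set E) := Submodule.isClosed_topologicalClosure _
  have hgM : ∀ i, g i ∈ M := fun i =>
    Submodule.le_topologicalClosure _ (Submodule.subset_span ⟨i, rfl⟩)
  have hM0 : M ≠ ⊥ := fun h => by
    obtain ⟨i⟩ := ‹Nonempty ι›
    exact hg i ((Submodule.mem_bot ℂ).1 (h ▸ hgM i))
  obtain ⟨m, hm, hbound, x, hxM, hx1, -, hfoc⟩ := hT.exists_minimizer hMc hM0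
  have hmt : ∀ i, m ^ 2 ≤ t i := fun i => by
    have h1 := pow_le_pow_left₀ (mul_nonneg hm (norm_nonneg _)) (hbound (g i) (hgM i)) 2
    have h2 := hTg i i
    rw [inner_self_eq_norm_sq_to_K, inner_self_eq_norm_sq_to_K] at h2
    have h3 : ‖T (g i)‖ ^ 2 = t i * ‖g i‖ ^ 2 :=
      Complex.ofReal_injective (by simpa using h2)
    rw [h3, mul_pow] at h1
    exact le_of_mul_le_mul_right h1 (pow_pos (norm_pos_iff.2 (hg i)) 2)
  have hma : m ^ 2 ≤ a := le_of_forall_pos_le_add fun ε hε => by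
    obtain ⟨i, hi⟩ := hinf ε hε
    exact (hmt i).trans hi.le
  have hdiag : ∀ i, ∀ v ∈ M, ⟪T (g i), T v⟫_ℂ = (t i : ℂ) * ⟪g i, v⟫_ℂ := fun i v hv => by
    have hle : M ≤ (innerSL ℂ (T (g i)) ∘L T - (t i : ℂ) • innerSL ℂ (g i)).ker := by
      refine Submodule.topologicalClosure_minimal _ (Submodule.span_le.2 ?_)
        (ContinuousLinearMap.isClosed_ker _)
      rintro _ ⟨j, rfl⟩
      simp [hTg]
    have := hle hv
    simpa [sub_eq_zero] using this
  -- `⟪T gᵢ, T x⟫` equals both `tᵢ ⟪gᵢ, x⟫` and `m² ⟪gᵢ, x⟫`, and `m² ≤ a < tᵢ`. So the minimizer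
  -- `x` is orthogonal to the space containing it.
  have horth : ∀ i, ⟪g i, x⟫_ℂ = 0 := fun i => by
    have h1 := hfoc (g i) (hgM i)
    have h2 : ⟪T (g i), T x⟫_ℂ = ((m ^ 2 : ℝ) : ℂ) * ⟪g i, x⟫_ℂ := by
      rw [← inner_conj_symm, h1, map_mul, Complex.conj_ofReal, inner_conj_symm]
    rw [hdiag i x hxM, ← sub_eq_zero, ← sub_mul, mul_eq_zero, ← Complex.ofReal_sub,
      Complex.ofReal_eq_zero] at h2
    exact h2.resolve_left (sub_pos.2 (hma.trans_lt (hlt i))).ne'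
  have hle : M ≤ (innerSL ℂ x).ker := by
    refine Submodule.topologicalClosure_minimal _ (Submodule.span_le.2 ?_)
      (ContinuousLinearMap.isClosed_ker _)
    rintro _ ⟨j, rfl⟩
    have : ⟪x, g j⟫_ℂ = 0 := inner_eq_zero_symm.1 (horth j)
    simpa using this
  have hxx : ⟪x, x⟫_ℂ = 0 := hle hxM
  rw [inner_self_eq_zero.1 hxx, norm_zero] at hx1
  exact zero_ne_one hx1

/-- A positive `AM` operator has an eigenvector in every nonzero closed invariant subspace. -/
theorem IsAbsolutelyMinimumAttaining.exists_eigenvector {T : E →L[ℂ] E}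
    (hT : IsAbsolutelyMinimumAttaining T) (hpos : T.IsPositive) {M : Submodule ℂ E}
    (hM : IsClosed (M : Set E)) (hM0 : M ≠ ⊥) (hinv : ∀ x ∈ M, T x ∈ M) :
    ∃ x ∈ M, ‖x‖ = 1 ∧ ∃ l : ℝ, T x = (l : ℂ) • x := by
  obtain ⟨m, hm, -, x, hxM, hx1, hTx, hfoc⟩ := hT.exists_minimizer hM hM0
  refine ⟨x, hxM, hx1, m, ?_⟩
  -- `T² x - m² x` lies in `M` by invariance and is orthogonal to `M` by the first order condition.
  have hsq : T (T x) = ((m ^ 2 : ℝ) : ℂ) • x := by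
    rw [← sub_eq_zero, ← inner_self_eq_zero (𝕜 := ℂ)]
    set v := T (T x) - ((m ^ 2 : ℝ) : ℂ) • x with hv
    have hvM : v ∈ M := M.sub_mem (hinv _ (hinv _ hxM)) (M.smul_mem _ hxM)
    have h1 := hfoc v hvM
    rw [← hpos.inner_left_eq_inner_right] at h1
    conv_lhs => lhs; rw [hv]
    rw [inner_sub_left, h1, inner_smul_left, Complex.conj_ofReal, sub_self]
  rcases hm.eq_or_lt with h0 | h0
  · rw [← h0] at hTx ⊢
    simpa using hTx
  · rw [← sub_eq_zero, ← norm_eq_zero]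
    -- `(T + m)(T - m) x = 0`, and a positive operator has no eigenvalue `-m < 0`.
    set y := T x - (m : ℂ) • x with hy
    have hTy : T y = -(m : ℂ) • y := by
      rw [hy, map_sub, map_smul, hsq]
      push_cast
      module
    have h1 := hpos.re_inner_nonneg_left y
    rw [hTy, inner_smul_left, inner_self_eq_norm_sq_to_K] at h1
    have h2 : (starRingEnd ℂ (-(m : ℂ)) * (‖y‖ : ℂ) ^ 2) = ((-m * ‖y‖ ^ 2 : ℝ) : ℂ) := by simp
    change 0 ≤ (starRingEnd ℂ (-(m : ℂ)) * (‖y‖ : ℂ) ^ 2).re at h1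
    rw [h2, Complex.ofReal_re] at h1
    have h3 : ‖y‖ ^ 2 ≤ 0 := by nlinarith [sq_nonneg ‖y‖]
    exact pow_eq_zero_iff two_ne_zero |>.1 (le_antisymm h3 (sq_nonneg _))

/-- A positive `AM` operator is diagonalizable. -/
theorem IsAbsolutelyMinimumAttaining.exists_hilbertBasis {T : E →L[ℂ] E}
    (hT : IsAbsolutelyMinimumAttaining T) (hpos : T.IsPositive) :
    ∃ (s : Set E) (b : HilbertBasis s ℂ E) (l : s → ℝ), ∀ i, T (b i) = (l i : ℂ) • b i := by
  classical
  obtain ⟨s, hs⟩ := zorn_subset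
    {s : Set E | Orthonormal ℂ (Subtype.val : s → E) ∧ ∀ v ∈ s, ∃ l : ℝ, T v = (l : ℂ) • v} (by
      intro c hc hchain
      refine ⟨⋃₀ c, ⟨orthonormal_sUnion_of_directed hchain.directedOn fun x hx => (hc hx).1, ?_⟩,
        fun _ => Set.subset_sUnion_of_mem⟩
      rintro v ⟨u, hu, hv⟩
      exact (hc hu).2 v hv)
  have horth := hs.prop.1
  have heig := hs.prop.2
  have hbot : (Submodule.span ℂ (Set.range (Subtype.val : s → E)))ᗮ = ⊥ := by
    rw [Subtype.range_coe]
    by_contra hne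
    have hmem : ∀ x, x ∈ (Submodule.span ℂ s)ᗮ ↔ ∀ v ∈ s, ⟪v, x⟫_ℂ = 0 := fun x => by
      rw [Submodule.mem_orthogonal]
      refine ⟨fun h v hv => h v (Submodule.subset_span hv), fun h v hv => ?_⟩
      have : Submodule.span ℂ s ≤ (innerSL ℂ x).ker := Submodule.span_le.2 fun w hw => by
        simpa using inner_eq_zero_symm.1 (h w hw)
      exact inner_eq_zero_symm.1 (this hv)
    obtain ⟨x, hx, hx1, hxl⟩ := hT.exists_eigenvector hpos (Submodule.isClosed_orthogonal _) hne
      (fun x hx => by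
        rw [hmem] at hx ⊢
        intro v hv
        obtain ⟨l, hl⟩ := heig v hv
        rw [← hpos.inner_left_eq_inner_right, hl, inner_smul_left, hx v hv, mul_zero])
    rw [hmem] at hx
    -- Maximality puts `x` in `s`, to which it is orthogonal.
    have hins : insert x s ≤ s := hs.le_of_ge (y := insert x s) ⟨?_, ?_⟩ (Set.subset_insert x s)
    · have h0 := hx x (hins (Set.mem_insert x s))
      rw [inner_self_eq_zero.1 h0, norm_zero] at hx1
      exact zero_ne_one hx1
    · rw [orthonormal_subtype_iff_ite] at horth ⊢
      have hxs : x ∉ s := fun hxs => by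
        rw [inner_self_eq_zero.1 (hx x hxs), norm_zero] at hx1
        exact zero_ne_one hx1
      rintro v (rfl | hv) w (rfl | hw)
      · rw [inner_self_eq_norm_sq_to_K, hx1]; simp
      · rw [if_neg (fun h : v = w => hxs (h ▸ hw)), inner_eq_zero_symm.1 (hx w hw)]
      · rw [if_neg (fun h : v = w => hxs (h ▸ hv)), hx v hv]
      · exact horth v hv w hw
    · rintro v (rfl | hv)
      · exact hxl
      · exact heig v hv
  choose l hl using fun i : s => heig i i.2
  refine ⟨s, HilbertBasis.mkOfOrthogonalEqBot horth hbot, l, fun i => ?_⟩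
  rw [HilbertBasis.coe_mkOfOrthogonalEqBot]
  exact hl i

end Minimizers

/-! ### Operators diagonal in a Hilbert basis -/

section Diagonal

variable {E ι : Type*} [NormedAddCommGroup E] [InnerProductSpace ℂ E]

/-- The finite rank operator that is diagonal with entries `k i`, `i ∈ s`. -/
noncomputable def finiteDiagonal (b : HilbertBasis ι ℂ E) (s : Finset ι) (k : ι → ℝ) : E →L[ℂ] E :=
  ∑ i ∈ s, (k i : ℂ) • InnerProductSpace.rankOne ℂ (b i) (b i)

open Classical in
theorem inner_finiteDiagonal (b : HilbertBasis ι ℂ E) (s : Finset ι) (k : ι → ℝ) (j : ι) (x : E) :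
    ⟪b j, finiteDiagonal b s k x⟫_ℂ = ((if j ∈ s then k j else 0 : ℝ) : ℂ) * ⟪b j, x⟫_ℂ := by
  simp only [finiteDiagonal, sum_apply, smul_apply, InnerProductSpace.rankOne_apply, inner_sum,
    inner_smul_right, orthonormal_iff_ite.1 b.orthonormal]
  by_cases hj : j ∈ s
  · rw [Finset.sum_eq_single_of_mem j hj]
    · simp [hj]
    · intro i _ hij
      simp [Ne.symm hij]
  · rw [Finset.sum_eq_zero]
    · simp [hj]
    · intro i hi
      have : j ≠ i := fun h => hj (h ▸ hi)
      simp [this]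

theorem isFiniteRank_finiteDiagonal (b : HilbertBasis ι ℂ E) (s : Finset ι) (k : ι → ℝ) :
    IsFiniteRank (finiteDiagonal b s k) := by
  rw [IsFiniteRank]
  have : FiniteDimensional ℂ (Submodule.span ℂ (b '' s)) :=
    FiniteDimensional.span_of_finite ℂ (s.finite_toSet.image b)
  refine Submodule.finiteDimensional_of_le (S₂ := Submodule.span ℂ (b '' s)) ?_
  rintro _ ⟨x, rfl⟩
  simp only [finiteDiagonal, coe_coe, sum_apply, smul_apply, InnerProductSpace.rankOne_apply]
  exact Submodule.sum_mem _ fun i hi => Submodule.smul_mem _ _ (Submodule.smul_mem _ _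
    (Submodule.subset_span ⟨i, hi, rfl⟩))

theorem hasSum_norm_inner_sq (b : HilbertBasis ι ℂ E) (x : E) :
    HasSum (fun i => ‖⟪b i, x⟫_ℂ‖ ^ 2) (‖x‖ ^ 2) := by
  have h := b.hasSum_inner_mul_inner x x
  rw [inner_self_eq_norm_sq_to_K] at h
  rw [← Complex.hasSum_ofReal]
  have hf : (fun i => ((‖⟪b i, x⟫_ℂ‖ ^ 2 : ℝ) : ℂ)) = fun i => ⟪x, b i⟫_ℂ * ⟪b i, x⟫_ℂ := by
    funext i
    rw [← inner_conj_symm x (b i), Complex.conj_mul', Complex.ofReal_pow]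
  rw [hf, Complex.ofReal_pow]
  exact h

theorem norm_le_of_diagonal (b : HilbertBasis ι ℂ E) {D : E →L[ℂ] E} {d : ι → ℝ}
    (hD : ∀ i x, ⟪b i, D x⟫_ℂ = (d i : ℂ) * ⟪b i, x⟫_ℂ) {ε : ℝ} (hε : 0 ≤ ε)
    (hd : ∀ i, |d i| ≤ ε) : ‖D‖ ≤ ε := by
  refine opNorm_le_bound _ hε fun x => ?_
  refine le_of_sq_le_sq ?_ (mul_nonneg hε (norm_nonneg x))
  rw [mul_pow]
  refine hasSum_le (fun i => ?_) (hasSum_norm_inner_sq b (D x))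
    ((hasSum_norm_inner_sq b x).mul_left (ε ^ 2))
  rw [hD, norm_mul, mul_pow, Complex.norm_real]
  exact mul_le_mul_of_nonneg_right (pow_le_pow_left₀ (norm_nonneg _) (hd i) 2) (sq_nonneg _)

theorem isPositive_of_diagonal [CompleteSpace E] (b : HilbertBasis ι ℂ E) {D : E →L[ℂ] E}
    {d : ι → ℝ} (hD : ∀ i x, ⟪b i, D x⟫_ℂ = (d i : ℂ) * ⟪b i, x⟫_ℂ) (hd : ∀ i, 0 ≤ d i) :
    D.IsPositive := by
  have hinner : ∀ x y, HasSum (fun i => (d i : ℂ) * (⟪x, b i⟫_ℂ * ⟪b i, y⟫_ℂ)) ⟪x, D y⟫_ℂ :=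
    fun x y => by
      have hf : (fun i => (d i : ℂ) * (⟪x, b i⟫_ℂ * ⟪b i, y⟫_ℂ)) =
          fun i => ⟪x, b i⟫_ℂ * ⟪b i, D y⟫_ℂ := by
        funext i
        rw [hD]; ring
      rw [hf]
      exact b.hasSum_inner_mul_inner x (D y)
  rw [isPositive_def']
  refine ⟨?_, fun x => ?_⟩
  · rw [isSelfAdjoint_iff_isSymmetric]
    intro x y
    have h := (hinner y x).map (starRingEnd ℂ) Complex.continuous_conj
    simp only [Function.comp_def, map_mul, Complex.conj_ofReal, inner_conj_symm] at h
    change ⟪D x, y⟫_ℂ = ⟪x, D y⟫_ℂ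
    refine h.unique ?_
    have hf : (fun i => (d i : ℂ) * (⟪b i, y⟫_ℂ * ⟪x, b i⟫_ℂ)) =
        fun i => (d i : ℂ) * (⟪x, b i⟫_ℂ * ⟪b i, y⟫_ℂ) := by
      funext i
      ring
    rw [hf]
    exact hinner x y
  · change 0 ≤ (⟪D x, x⟫_ℂ).re
    rw [← inner_conj_symm, Complex.conj_re]
    refine (Complex.hasSum_re (hinner x x)).nonneg fun i => ?_
    rw [← inner_conj_symm x (b i), Complex.conj_mul', Complex.re_ofReal_mul]
    refine mul_nonneg (hd i) ?_
    rw [← Complex.ofReal_pow, Complex.ofReal_re]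
    positivity

/-- Truncating to the finitely many entries of size at least `ε / 2` approximates `D` in norm by
finite rank operators. -/
theorem isCompactOperator_of_diagonal [CompleteSpace E] (b : HilbertBasis ι ℂ E) {D : E →L[ℂ] E}
    {d : ι → ℝ} (hD : ∀ i x, ⟪b i, D x⟫_ℂ = (d i : ℂ) * ⟪b i, x⟫_ℂ)
    (hd : Tendsto d cofinite (𝓝 0)) : IsCompactOperator D := by
  classical
  have hcl : D ∈ closure {f : E →L[ℂ] E | IsCompactOperator f} := by
    refine Metric.mem_closure_iff.2 fun ε hε => ?_
    have hfin : {i | ¬ |d i| < ε / 2}.Finite := by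
      have := (Metric.tendsto_nhds.1 hd) (ε / 2) (half_pos hε)
      simpa [Real.dist_eq] using this
    refine ⟨finiteDiagonal b hfin.toFinset d,
      (isFiniteRank_finiteDiagonal b _ d).isCompactOperator, ?_⟩
    rw [dist_eq_norm]
    refine lt_of_le_of_lt (norm_le_of_diagonal b
      (d := fun i => d i - if i ∈ hfin.toFinset then d i else 0) (fun i x => ?_)
      (half_pos hε).le fun i => ?_) (half_lt_self hε)
    · rw [sub_apply, inner_sub_right, hD, inner_finiteDiagonal]
      push_cast
      ring
    · by_cases hi : |d i| < ε / 2
      · have : i ∉ hfin.toFinset := by simpa using hi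
        rw [if_neg this, sub_zero]
        exact hi.le
      · have : i ∈ hfin.toFinset := by simpa using hi
        rw [if_pos this, sub_self, abs_zero]
        exact (half_pos hε).le
  exact isClosed_setOfPred_isCompactOperator.closure_subset hcl

end Diagonal

/-! ### Necessity: the eigenvalues of a positive AM operator -/

section Structure

variable {E ι : Type*} [NormedAddCommGroup E] [InnerProductSpace ℂ E] [CompleteSpace E]

/-- The eigenvalues of an `AM` operator cannot accumulate both below `p` and above `r > p`. -/
theorem IsAbsolutelyMinimumAttaining.not_infinite_lt_and_infinite_gt {T : E →L[ℂ] E}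
    (hT : IsAbsolutelyMinimumAttaining T) {b : ι → E} (hb : Orthonormal ℂ b) {l : ι → ℝ}
    (hl : ∀ i, 0 ≤ l i) (hTb : ∀ i, T (b i) = (l i : ℂ) • b i) {p r : ℝ} (hpr : p < r)
    (hp : {i | l i < p}.Infinite) (hr : {i | r < l i}.Infinite) : False := by
  classical
  let e := hp.natEmbedding
  let f := hr.natEmbedding
  have he : ∀ n, l (e n) < p := fun n => (e n).2
  have hf : ∀ n, r < l (f n) := fun n => (f n).2
  have hp0 : 0 < p := (hl _).trans_lt (he 0)
  have hsq : 0 < r ^ 2 - p ^ 2 := by nlinarith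
  -- Values in `(p², r²]` decreasing to `p²` without reaching it, to contradict `not_forall_lt`.
  let t : ℕ → ℝ := fun n => p ^ 2 + (r ^ 2 - p ^ 2) / (n + 1)
  have htp : ∀ n, p ^ 2 < t n := fun n => lt_add_of_pos_right _ (by positivity)
  have htr : ∀ n, t n ≤ r ^ 2 := fun n => by
    have : (r ^ 2 - p ^ 2) / (n + 1) ≤ r ^ 2 - p ^ 2 :=
      div_le_self hsq.le (by linarith [Nat.cast_nonneg (α := ℝ) n])
    simp only [t]; linarith
  -- The weights solve `c² l(e)² + d² l(f)² = t (c² + d²)`, so `‖T g‖² = t ‖g‖²` for `g = c b(e) + d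
  -- b(f)`.
  let c : ℕ → ℝ := fun n => √(l (f n) ^ 2 - t n)
  let d : ℕ → ℝ := fun n => √(t n - l (e n) ^ 2)
  have hc : ∀ n, c n * c n = l (f n) ^ 2 - t n := fun n =>
    Real.mul_self_sqrt (by nlinarith [htr n, hf n])
  have hd : ∀ n, d n * d n = t n - l (e n) ^ 2 := fun n =>
    Real.mul_self_sqrt (by nlinarith [htp n, he n, hl (e n)])
  have hinj : ∀ n m, (e n : ι) = e m ↔ n = m := fun n m => by
    rw [Subtype.coe_inj, e.injective.eq_iff]
  have hinj' : ∀ n m, (f n : ι) = f m ↔ n = m := fun n m => by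
    rw [Subtype.coe_inj, f.injective.eq_iff]
  have hne : ∀ n m, (e n : ι) ≠ f m := fun n m h => by
    have h1 := he n
    have h2 := hf m
    rw [h] at h1
    linarith
  let g : ℕ → E := fun n => (c n : ℂ) • b (e n) + (d n : ℂ) • b (f n)
  have hgg : ∀ n m, ⟪g n, g m⟫_ℂ = if n = m then ((c n * c n + d n * d n : ℝ) : ℂ) else 0 :=
    fun n m => by
      simp only [g, inner_add_left, inner_add_right, inner_smul_left, inner_smul_right,
        orthonormal_iff_ite.1 hb, hinj, hinj', hne, (hne _ _).symm, Complex.conj_ofReal, if_false]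
      split_ifs with h
      · subst h; push_cast; ring
      · ring
  have hTg : ∀ n, T (g n) = ((c n * l (e n) : ℝ) : ℂ) • b (e n) +
      ((d n * l (f n) : ℝ) : ℂ) • b (f n) := fun n => by
    simp only [g, map_add, map_smul, hTb, smul_smul, Complex.ofReal_mul]
  refine hT.not_forall_lt (g := g) (t := t) (a := p ^ 2) (fun n h0 => ?_) (fun n m => ?_)
    (fun ε hε => ?_) htp
  · have h := hgg n n
    rw [h0, inner_zero_left, if_pos rfl, hc, hd, eq_comm, Complex.ofReal_eq_zero] at h
    nlinarith [he n, hf n, hl (e n)]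
  · rw [hgg, hTg, hTg]
    simp only [inner_add_left, inner_add_right, inner_smul_left, inner_smul_right,
        orthonormal_iff_ite.1 hb, hinj, hinj', hne, (hne _ _).symm, Complex.conj_ofReal, if_false]
    split_ifs with h
    · subst h
      have : c n * l (e n) * (c n * l (e n)) + d n * l (f n) * (d n * l (f n)) =
          t n * (c n * c n + d n * d n) := by
        have h1 := hc n
        have h2 := hd n
        calc _ = (c n * c n) * l (e n) ^ 2 + (d n * d n) * l (f n) ^ 2 := by ring
          _ = _ := by rw [h1, h2]; ring
      rw [← Complex.ofReal_mul, ← this]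
      push_cast
      ring
    · ring
  · obtain ⟨n, hn⟩ := exists_nat_gt ((r ^ 2 - p ^ 2) / ε)
    refine ⟨n, ?_⟩
    have hn1 : (0 : ℝ) < n + 1 := by positivity
    have : (r ^ 2 - p ^ 2) / (n + 1) < ε := by
      rw [div_lt_iff₀ hε] at hn
      rw [div_lt_iff₀ hn1]
      nlinarith
    simp only [t]; linarith

/-- A positive `AM` operator is of the form `β - K + F` with `K` positive compact and `F` of
finite rank. -/
theorem IsAbsolutelyMinimumAttaining.exists_eq_sub_add {T : E →L[ℂ] E}
    (hT : IsAbsolutelyMinimumAttaining T) (hpos : T.IsPositive) :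
    ∃ (β : ℝ) (K G : E →L[ℂ] E), K.IsPositive ∧ IsCompactOperator K ∧ IsFiniteRank G ∧
      T = (β : ℂ) • ContinuousLinearMap.id ℂ E - K + G := by
  classical
  obtain ⟨s, b, l, hTb⟩ := hT.exists_hilbertBasis hpos
  have hb1 : ∀ i, ‖b i‖ = 1 := b.orthonormal.1
  have hl : ∀ i, 0 ≤ l i := fun i => by
    have h := hpos.re_inner_nonneg_right (b i)
    rw [hTb, inner_smul_right, inner_self_eq_norm_sq_to_K, hb1] at h
    simpa using h
  have hlT : ∀ i, l i ≤ ‖T‖ := fun i => by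
    have h := T.le_opNorm (b i)
    rwa [hTb, norm_smul, hb1, mul_one, mul_one, Complex.norm_real, Real.norm_of_nonneg (hl i)] at h
  have hdiagT : ∀ i x, ⟪b i, T x⟫_ℂ = (l i : ℂ) * ⟪b i, x⟫_ℂ := fun i x => by
    rw [← hpos.inner_left_eq_inner_right, hTb, inner_smul_left, Complex.conj_ofReal]
  obtain ⟨β, hβ⟩ : ∃ β, Tendsto l cofinite (𝓝 β) := by
    refine tendsto_of_no_upcrossings dense_univ (fun p _ r _ hpr ⟨h1, h2⟩ => ?_)
      (isBoundedUnder_of ⟨‖T‖, hlT⟩) (isBoundedUnder_of ⟨0, hl⟩)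
    rw [frequently_cofinite_iff_infinite] at h1 h2
    exact hT.not_infinite_lt_and_infinite_gt b.orthonormal hl hTb hpr h1 h2
  -- Infinitely many eigenvalues above `β` would have infimum `β`, not attained on the span of their
  -- eigenvectors.
  have hfin : {i | β < l i}.Finite := by
    by_contra hinf
    have : Infinite {i | β < l i} := Set.infinite_coe_iff.2 hinf
    have : Nonempty {i | β < l i} := inferInstance
    have hcomp : Tendsto (fun i : {i | β < l i} => l i) cofinite (𝓝 β) :=
      hβ.comp Subtype.val_injective.tendsto_cofinite
    have hβ0 : 0 ≤ β := ge_of_tendsto' hcomp fun i => hl i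
    refine hT.not_forall_lt (ι := {i | β < l i}) (g := fun i => b i) (t := fun i => l i ^ 2)
      (a := β ^ 2) (fun i h0 => ?_) (fun i j => ?_) (fun ε hε => ?_)
      (fun i => pow_lt_pow_left₀ i.2 hβ0 two_ne_zero)
    · have := hb1 i
      rw [h0, norm_zero] at this
      exact zero_ne_one this
    · rw [hpos.inner_left_eq_inner_right, hdiagT, hdiagT]
      push_cast
      ring
    · exact ((hcomp.pow 2).eventually_lt_const (lt_add_of_pos_right _ hε)).exists
  -- `G` carries the excess of the finitely many eigenvalues above `β`; `K` keeps the deficits `β -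
  -- l i ≥ 0`, which tend to zero.
  let G := finiteDiagonal b hfin.toFinset fun i => l i - β
  let K := (β : ℂ) • ContinuousLinearMap.id ℂ E + G - T
  let k : s → ℝ := fun i => if β < l i then 0 else β - l i
  have hdiagK : ∀ i x, ⟪b i, K x⟫_ℂ = (k i : ℂ) * ⟪b i, x⟫_ℂ := fun i x => by
    simp only [K, G, sub_apply, add_apply, smul_apply, ContinuousLinearMap.id_apply,
      inner_sub_right, inner_add_right, inner_smul_right, inner_finiteDiagonal, hdiagT,
      Set.Finite.mem_toFinset, Set.mem_ofPred_eq, k]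
    split_ifs
    · push_cast; ring
    · push_cast; ring
  have hk0 : ∀ i, 0 ≤ k i := fun i => by
    simp only [k]
    split_ifs with h
    · exact le_rfl
    · linarith
  have hk : Tendsto k cofinite (𝓝 0) := by
    have h1 : Tendsto (fun i => |β - l i|) cofinite (𝓝 0) := by
      simpa using (hβ.const_sub β).abs
    refine squeeze_zero hk0 (fun i => ?_) h1
    simp only [k]
    split_ifs
    · exact abs_nonneg _
    · exact le_abs_self _
  refine ⟨β, K, G, isPositive_of_diagonal b hdiagK hk0, isCompactOperator_of_diagonal b hdiagK hk,
    isFiniteRank_finiteDiagonal b _ _, ?_⟩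
  simp only [K]
  abel

end Structure

/-! ### Block operators -/

section Block

variable {H₁ H₂ : Type*} [NormedAddCommGroup H₁] [InnerProductSpace ℂ H₁]
  [NormedAddCommGroup H₂] [InnerProductSpace ℂ H₂]

variable (H₁ H₂) in
/-- The inclusion of the first summand. -/
noncomputable def inclFst : H₁ →L[ℂ] WithLp 2 (H₁ × H₂) :=
  ((WithLp.prodContinuousLinearEquiv 2 ℂ H₁ H₂).symm : H₁ × H₂ →L[ℂ] WithLp 2 (H₁ × H₂)) ∘L
    inl ℂ H₁ H₂

variable (H₁ H₂) in
/-- The inclusion of the second summand. -/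
noncomputable def inclSnd : H₂ →L[ℂ] WithLp 2 (H₁ × H₂) :=
  ((WithLp.prodContinuousLinearEquiv 2 ℂ H₁ H₂).symm : H₁ × H₂ →L[ℂ] WithLp 2 (H₁ × H₂)) ∘L
    inr ℂ H₁ H₂

theorem inclFst_apply (x : H₁) : inclFst H₁ H₂ x = WithLp.toLp 2 (x, 0) := rfl

theorem inclSnd_apply (x : H₂) : inclSnd H₁ H₂ x = WithLp.toLp 2 (0, x) := rfl

variable [CompleteSpace H₁] [CompleteSpace H₂]

theorem adjoint_inclFst_apply (v : WithLp 2 (H₁ × H₂)) : adjoint (inclFst H₁ H₂) v = v.fst := by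
  refine ext_inner_right ℂ fun z => ?_
  rw [adjoint_inner_left, inclFst_apply, WithLp.prod_inner_apply]
  simp

theorem adjoint_inclSnd_apply (v : WithLp 2 (H₁ × H₂)) : adjoint (inclSnd H₁ H₂) v = v.snd := by
  refine ext_inner_right ℂ fun z => ?_
  rw [adjoint_inner_left, inclSnd_apply, WithLp.prod_inner_apply]
  simp

/-- If a positive block operator with identity lower right corner is `AM`, then it is `1 - K + F`
with `K` positive compact and of finite rank on the second summand. -/
theorem of_isAbsolutelyMinimumAttaining_blockOperator (hH₁ : ¬ FiniteDimensional ℂ H₁)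
    (hH₂ : ¬ FiniteDimensional ℂ H₂) {A : H₁ →L[ℂ] H₁} (hA : A.IsPositive) {X : H₂ →L[ℂ] H₁}
    (hT : (blockOperator A X (adjoint X) (ContinuousLinearMap.id ℂ H₂)).IsPositive)
    (hAM : IsAbsolutelyMinimumAttaining
      (blockOperator A X (adjoint X) (ContinuousLinearMap.id ℂ H₂))) :
    IsAbsolutelyMinimumAttaining A ∧ essentialSpectrum A = {1} ∧ IsFiniteRank X := by
  obtain ⟨β, K, G, hK, hKc, hG, hTKG⟩ := hAM.exists_eq_sub_add hT
  set V := inclFst H₁ H₂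
  set W := inclSnd H₁ H₂
  have happ : ∀ v, blockOperator A X (adjoint X) (ContinuousLinearMap.id ℂ H₂) v =
      (β : ℂ) • v - K v + G v := fun v => by rw [hTKG]; rfl
  have h22 : ∀ y, y = (β : ℂ) • y - (K (W y)).snd + (G (W y)).snd := fun y => by
    have h := congr_arg WithLp.snd (happ (W y))
    simpa [blockOperator_apply, W, inclSnd_apply] using h
  have h12 : ∀ y, X y = - (K (W y)).fst + (G (W y)).fst := fun y => by
    have h := congr_arg WithLp.fst (happ (W y))
    simpa [blockOperator_apply, W, inclSnd_apply] using h
  have h11 : ∀ x, A x = (β : ℂ) • x - (K (V x)).fst + (G (V x)).fst := fun x => by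
    have h := congr_arg WithLp.fst (happ (V x))
    simpa [blockOperator_apply, V, inclFst_apply] using h
  have hGW : IsFiniteRank (adjoint W ∘L G ∘L W) := (hG.comp_clm W).clm_comp _
  have hKW : IsCompactOperator (adjoint W ∘L K ∘L W) := (hKc.comp_clm W).clm_comp (adjoint W)
  -- The lower right corner reads `1 - β = G₂₂ - K₂₂`, which is compact, while `H₂` is
  -- infinite-dimensional.
  have hβ : β = 1 := by
    by_contra hne
    have hd : (1 - β : ℂ) ≠ 0 := by
      rw [sub_ne_zero]
      exact_mod_cast Ne.symm hne
    have hc : IsCompactOperator (adjoint W ∘L G ∘L W - adjoint W ∘L K ∘L W) :=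
      hGW.isCompactOperator.sub hKW
    have hid : ⇑(ContinuousLinearMap.id ℂ H₂) =
        (1 - β : ℂ)⁻¹ • ⇑(adjoint W ∘L G ∘L W - adjoint W ∘L K ∘L W) := by
      funext y
      simp only [ContinuousLinearMap.id_apply, Pi.smul_apply, sub_apply, comp_apply, W,
        adjoint_inclSnd_apply]
      rw [eq_inv_smul_iff₀ hd, sub_smul, one_smul, sub_eq_iff_eq_add]
      conv_lhs => rw [h22 y]
      abel
    exact hH₂ (FiniteDimensional.of_isCompactOperator_id (𝕜 := ℂ)
      (hid ▸ hc.smul (1 - β : ℂ)⁻¹ : IsCompactOperator (ContinuousLinearMap.id ℂ H₂)))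
  subst hβ
  -- Now `K₂₂ = G₂₂`. Where it vanishes, the form of `K` vanishes at `W y`, so positivity gives `K
  -- (W y) = 0`.
  have hKfin : IsFiniteRank (K ∘L W) := hGW.of_ker_le fun y hy => by
    refine apply_eq_zero_of_re_inner_eq_zero hK ?_
    have hy' : (G (W y)).snd = 0 := by rw [← adjoint_inclSnd_apply]; exact hy
    have h := h22 y
    rw [hy', Complex.ofReal_one, one_smul, add_zero, eq_comm, sub_eq_self] at h
    change (⟪K (W y), W y⟫_ℂ).re = 0
    rw [← adjoint_inner_left, adjoint_inclSnd_apply, h, inner_zero_left, Complex.zero_re]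
  have hXeq : X = adjoint V ∘L (G ∘L W - K ∘L W) := by
    ext y
    simp only [comp_apply, sub_apply, V, adjoint_inclFst_apply, h12, WithLp.sub_fst]
    abel
  have hAeq : A = ((1 : ℝ) : ℂ) • ContinuousLinearMap.id ℂ H₁ - adjoint V ∘L K ∘L V +
      adjoint V ∘L G ∘L V := by
    ext x
    simp only [comp_apply, sub_apply, add_apply, smul_apply, ContinuousLinearMap.id_apply, V,
      adjoint_inclFst_apply, h11]
  have hKV : IsCompactOperator (adjoint V ∘L K ∘L V) := (hKc.comp_clm V).clm_comp (adjoint V)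
  have hGV : IsFiniteRank (adjoint V ∘L G ∘L V) := (hG.comp_clm V).clm_comp _
  refine ⟨isAbsolutelyMinimumAttaining_of_eq zero_le_one hA (hK.adjoint_conj V) hKV hGV hAeq,
    ?_, ?_⟩
  · rw [hAeq, sub_add_eq_add_sub, add_sub_assoc, essentialSpectrum_smul_id_add hH₁
      (hGV.isCompactOperator.sub hKV), Complex.ofReal_one]
  · rw [hXeq]
    exact ((hG.comp_clm W).sub hKfin).clm_comp _

/-- The essential spectrum gives `A = 1 - K + G`. Extending `K` by zero keeps it positive and
compact, and everything else in the block operator minus the identity has finite rank. -/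
theorem isAbsolutelyMinimumAttaining_blockOperator (hH₁ : ¬ FiniteDimensional ℂ H₁)
    {A : H₁ →L[ℂ] H₁} (hA : A.IsPositive) {X : H₂ →L[ℂ] H₁}
    (hT : (blockOperator A X (adjoint X) (ContinuousLinearMap.id ℂ H₂)).IsPositive)
    (hAM : IsAbsolutelyMinimumAttaining A) (hσ : essentialSpectrum A = {1})
    (hX : IsFiniteRank X) : IsAbsolutelyMinimumAttaining
      (blockOperator A X (adjoint X) (ContinuousLinearMap.id ℂ H₂)) := by
  obtain ⟨β, K, G, hK, hKc, hG, hAKG⟩ := hAM.exists_eq_sub_add hA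
  have hβ : β = 1 := by
    rw [hAKG, sub_add_eq_add_sub, add_sub_assoc, essentialSpectrum_smul_id_add hH₁
      (hG.isCompactOperator.sub hKc), Set.singleton_eq_singleton_iff] at hσ
    exact_mod_cast hσ
  subst hβ
  set V := inclFst H₁ H₂
  set W := inclSnd H₁ H₂
  have hXadj : IsFiniteRank (W ∘L adjoint X ∘L adjoint V) :=
    (hX.adjoint.comp_clm _).clm_comp W
  have hXV : IsFiniteRank (V ∘L X ∘L adjoint W) := (hX.comp_clm _).clm_comp V
  have hGV : IsFiniteRank (V ∘L G ∘L adjoint V) := (hG.comp_clm _).clm_comp V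
  have hKV : IsCompactOperator (V ∘L K ∘L adjoint V) := (hKc.comp_clm (adjoint V)).clm_comp V
  refine isAbsolutelyMinimumAttaining_of_eq zero_le_one hT (hK.conj_adjoint V) hKV
    (hGV.add (hXV.add hXadj)) ?_
  have hAapp : ∀ x, A x = x - K x + G x := fun x => by rw [hAKG]; simp
  refine ContinuousLinearMap.ext fun v => WithLp.ofLp_injective 2 (Prod.ext ?_ ?_)
  · simp [blockOperator_apply, V, W, adjoint_inclFst_apply, adjoint_inclSnd_apply,
      inclFst_apply, inclSnd_apply, hAapp]
    abel
  · simp [blockOperator_apply, V, W, adjoint_inclFst_apply, adjoint_inclSnd_apply,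
      inclFst_apply, inclSnd_apply, add_comm]

end Block

end BlockAM

theorem mainTheorem7 {H₁ H₂ : Type*}
    [NormedAddCommGroup H₁] [InnerProductSpace ℂ H₁] [CompleteSpace H₁]
    [TopologicalSpace.SeparableSpace H₁]
    [NormedAddCommGroup H₂] [InnerProductSpace ℂ H₂] [CompleteSpace H₂]
    [TopologicalSpace.SeparableSpace H₂]
    (hH₁ : ¬ FiniteDimensional ℂ H₁) (hH₂ : ¬ FiniteDimensional ℂ H₂)
    (A : H₁ →L[ℂ] H₁) (hA : A.IsPositive) (X : H₂ →L[ℂ] H₁)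
    (hT : (BlockAM.blockOperator A X (ContinuousLinearMap.adjoint X)
      (ContinuousLinearMap.id ℂ H₂)).IsPositive) :
    BlockAM.IsAbsolutelyMinimumAttaining
        (BlockAM.blockOperator A X (ContinuousLinearMap.adjoint X)
          (ContinuousLinearMap.id ℂ H₂)) ↔
      (BlockAM.IsAbsolutelyMinimumAttaining A ∧ BlockAM.essentialSpectrum A = {1} ∧
        BlockAM.IsFiniteRank X) :=
  ⟨BlockAM.of_isAbsolutelyMinimumAttaining_blockOperator hH₁ hH₂ hA hT, fun ⟨h1, h2, h3⟩ =>
    BlockAM.isAbsolutelyMinimumAttaining_blockOperator hH₁ hA hT h1 h2 h3⟩
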